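/- For $n\ge 1$ let $f_n:\mathbb{R}^n\to\mathbb{R}$ be the function $f_n(x)=\frac{1-\|x\|}{1-\|x\|^{9}}$, where $\|\cdot\|$ is the Euclidean norm, and let $h(t)=\frac{1-t^{1/2}}{1-t^{9/2}}$ for $t>0$; where $\|x\|=1$, respectively $t=1$, the quotient is given its limiting value $1/9$. A continuous function $f:\mathbb{R}^n\to\mathbb{R}$ is called positive definite if for every $m$ and all $x_1,\dots,x_m\in\mathbb{R}^n$ the matrix $[f(x_i-x_j)]_{i,j=1}^m$ is positive semidefinite; a nonnegative $C^\infty$ function $g$ on $(0,\infty)$ is called completely monotone if $(-1)^k g^{(k)}(t)\ge 0$ for all $k\ge 0$ and $t>0$; a positive function $g$ on $(0,\infty)$ is called log-convex if $\log g$ is convex. Every $f_n$ is continuous, and $h$ is positive and $C^\infty$ on $(0,\infty)$. Moreover: 1. midpoint log-convexity of $h$ fails at $9/25$ and $16/25$, that is, $h\left(\frac{9/25+16/25}{2}\right)^2 > h(9/25)\,h(16/25)$; 2. hence $h$ is not log-convex on $(0,\infty)$; 3. $h$ is not completely monotone; 4. it is not the case that $f_n$ is positive definite on $\mathbb{R}^n$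 for every $n\ge 1$; that is, there is an $n\ge1$ for which $f_n$ is not positive definite. -/

import Mathlib

open Set

noncomputable section

/-- The function `x ↦ (1 - ‖x‖) / (1 - ‖x‖ ^ r)` on `ℝⁿ` with the Euclidean norm; where `‖x‖ = 1`
its value is the limit `1 / r`. -/
def normRatio (r : ℝ) (n : ℕ) (x : EuclideanSpace ℝ (Fin n)) : ℝ :=
  if ‖x‖ = 1 then 1 / r else (1 - ‖x‖) / (1 - ‖x‖ ^ r)

/-- The function `t ↦ (1 - t ^ (1/2)) / (1 - t ^ (r/2))` on the positive half-line; its value at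
`t = 1` is the limit `1 / r`. Only the values at `t > 0` matter. -/
def halfRatio (r : ℝ) (t : ℝ) : ℝ :=
  if t = 1 then 1 / r else (1 - t ^ (1 / 2 : ℝ)) / (1 - t ^ (r / 2))

/-- A real function `f` on `ℝⁿ` is positive definite if it is continuous and every matrix
`[f (xᵢ - xⱼ)]` is (real symmetric and) positive semidefinite. -/
def IsPositiveDefiniteFun {n : ℕ} (f : EuclideanSpace ℝ (Fin n) → ℝ) : Prop :=
  Continuous f ∧ ∀ (m : ℕ) (x : Fin m → EuclideanSpace ℝ (Fin n)),
    (Matrix.of fun i j : Fin m => f (x i - x j)).PosSemidef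

/-- A function on `(0, ∞)` is completely monotone if it is nonnegative and smooth there and
`(-1) ^ k * f⁽ᵏ⁾ (t) ≥ 0` for all `k ≥ 0` and `t > 0` (nonnegativity is the case `k = 0`).
Derivatives at `t > 0` depend only on the values of `f` on `(0, ∞)`. -/
def IsCompletelyMonotone (f : ℝ → ℝ) : Prop :=
  ContDiffOn ℝ (⊤ : ℕ∞) f (Ioi 0) ∧
    ∀ (k : ℕ) (t : ℝ), 0 < t → 0 ≤ (-1) ^ k * iteratedDeriv k f t

end

/-! With `s = √t`, `h` is the reciprocal of `1 + s + ... + s^8`. Complete monotonicity of `h`, and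
positive definiteness in all dimensions, would each make `h` a mixture of exponentials, hence
midpoint log-convex by Cauchy–Schwarz; one numerical violation then refutes both, and log-convexity
too. The two implications are proved without integral representations: each hypothesis yields `0 ≤
n² Q(u, v) + n R` for all `n > 0`, where `Q` is the quadratic form with coefficients `h(a)`, `2
h((a+b)/2)`, `h(b)`. Thus `Q ≥ 0`, and its discriminant gives the inequality. -/

open Polynomial in
/-- The second moment of the Bernstein distribution, as an identity of polynomials. -/
theorem bernsteinPolynomial_sum_sq (n : ℕ) (u v : ℝ) :
    ∑ k ∈ Finset.range (n + 1), C ((n * u + k * v) ^ 2) * bernsteinPolynomial ℝ n k =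
      C ((n : ℝ) ^ 2) * (C u + C v * X) ^ 2 + C (n * v ^ 2) * (X * (1 - X)) := by
  have h0 := bernsteinPolynomial.sum ℝ n
  have h1 := bernsteinPolynomial.sum_smul ℝ n
  have h2 := bernsteinPolynomial.variance ℝ n
  simp only [nsmul_eq_mul] at h1 h2
  -- Write `n u + k v = n (u + v X) - v (n X - k)` and expand the square, leaving the total mass,
  -- mean and variance.
  have key : ∀ k ∈ Finset.range (n + 1),
      C ((n * u + k * v) ^ 2) * bernsteinPolynomial ℝ n k =
        ((n : ℝ[X]) ^ 2 * (C u + C v * X) ^ 2 - 2 * (n : ℝ[X]) ^ 2 * X * (C u + C v * X) * C v)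
          * bernsteinPolynomial ℝ n k
        + 2 * (n : ℝ[X]) * (C u + C v * X) * C v * ((k : ℝ[X]) * bernsteinPolynomial ℝ n k)
        + C v ^ 2 * (((n : ℝ[X]) * X - (k : ℝ[X])) ^ 2 * bernsteinPolynomial ℝ n k) := by
    intro k _
    simp only [map_pow, map_add, map_mul, map_natCast]
    ring
  rw [Finset.sum_congr rfl key, Finset.sum_add_distrib, Finset.sum_add_distrib, ← Finset.mul_sum,
    ← Finset.mul_sum, ← Finset.mul_sum, h0, h1, h2]
  simp only [map_pow, map_mul, map_natCast]
  ring

theorem nonneg_of_forall_nat_sq_mul_add {Q R : ℝ}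
    (h : ∀ n : ℕ, 0 < n → 0 ≤ (n : ℝ) ^ 2 * Q + n * R) : 0 ≤ Q := by
  by_contra! hQ
  obtain ⟨n, hn⟩ := exists_nat_gt (|R| / -Q)
  have hn0 : (0 : ℝ) < n := lt_of_le_of_lt (by have := neg_pos.2 hQ; positivity) hn
  rw [div_lt_iff₀ (neg_pos.2 hQ)] at hn
  have h1 := h n (by exact_mod_cast hn0)
  have h2 : (n : ℝ) * Q + R < 0 := by linarith [le_abs_self R]
  nlinarith

theorem sq_le_mul_of_quadratic_nonneg {A B D : ℝ}
    (h : ∀ u v : ℝ, 0 ≤ u ^ 2 * A + 2 * u * v * B + v ^ 2 * D) : B ^ 2 ≤ A * D := by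
  have := discrim_le_zero (a := A) (b := 2 * B) (c := D) fun x => by linarith [h x 1]
  rw [discrim] at this
  linarith

namespace IsCompletelyMonotone

variable {g : ℝ → ℝ} {d : ℝ}

theorem contDiffAt (hg : IsCompletelyMonotone g) (k : ℕ) {t : ℝ} (ht : 0 < t) :
    ContDiffAt ℝ k g t :=
  (hg.1.contDiffAt (Ioi_mem_nhds ht)).of_le (by exact_mod_cast le_top)

theorem antitoneOn (hg : IsCompletelyMonotone g) (k : ℕ) :
    AntitoneOn (fun t => (-1) ^ k * iteratedDeriv k g t) (Ioi 0) := by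
  have hd : ∀ t ∈ Ioi (0 : ℝ), DifferentiableAt ℝ (iteratedDeriv k g) t := by
    intro t ht
    have h1 : EqOn (iteratedDerivWithin k g (Ioi 0)) (iteratedDeriv k g) (Ioi 0) :=
      iteratedDerivWithin_of_isOpen isOpen_Ioi
    have h2 := hg.1.differentiableOn_iteratedDerivWithin (m := k)
      (by exact_mod_cast WithTop.coe_lt_top k) (uniqueDiffOn_Ioi 0)
    exact ((h2.congr fun x hx => (h1 hx).symm) t ht).differentiableAt (Ioi_mem_nhds ht)
  apply antitoneOn_of_deriv_nonpos (convex_Ioi 0)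
  · exact fun t ht => ((hd t ht).const_mul _).continuousAt.continuousWithinAt
  · rw [interior_Ioi]
    exact fun t ht => ((hd t ht).const_mul _).differentiableWithinAt
  · rw [interior_Ioi]
    intro t ht
    have h := hg.2 (k + 1) t ht
    rw [deriv_const_mul _ (hd t ht), ← iteratedDeriv_succ]
    rw [pow_succ] at h
    linarith

theorem comp_add (hg : IsCompletelyMonotone g) (hd : 0 ≤ d) :
    IsCompletelyMonotone fun t => g (t + d) := by
  refine ⟨hg.1.comp (by fun_prop) fun t (ht : 0 < t) => add_pos_of_pos_of_nonneg ht hd,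
    fun k t ht => ?_⟩
  rw [iteratedDeriv_comp_add_const]
  exact hg.2 k _ (by positivity)

/-- Each signed derivative of `g` is decreasing, so its value at `t` dominates that at `t + d`. -/
theorem sub_comp_add (hg : IsCompletelyMonotone g) (hd : 0 ≤ d) :
    IsCompletelyMonotone fun t => g t - g (t + d) := by
  refine ⟨hg.1.sub (hg.comp_add hd).1, fun k t ht => ?_⟩
  rw [iteratedDeriv_fun_sub (hg.contDiffAt k ht) ((hg.comp_add hd).contDiffAt k ht),
    iteratedDeriv_comp_add_const, mul_sub, sub_nonneg]
  exact hg.antitoneOn k ht (add_pos_of_pos_of_nonneg ht hd) (by linarith)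

/-- Completely monotone functions satisfy the Turán inequality, i.e. they are midpoint
log-convex. -/
theorem sq_le_mul (hg : IsCompletelyMonotone g) {a : ℝ} (ha : 0 < a) (hd : 0 ≤ d) :
    g (a + d) ^ 2 ≤ g a * g (a + d + d) := by
  let S : Module.End ℝ (ℝ → ℝ) := LinearMap.funLeft ℝ ℝ (· + d)
  have hS : ∀ f, IsCompletelyMonotone f → IsCompletelyMonotone (S f) :=
    fun f hf => hf.comp_add hd
  have hS' : ∀ f, IsCompletelyMonotone f → IsCompletelyMonotone ((1 - S) f) :=
    fun f hf => hf.sub_comp_add hd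
  have hpow : ∀ (T : Module.End ℝ (ℝ → ℝ)),
      (∀ f, IsCompletelyMonotone f → IsCompletelyMonotone (T f)) →
      ∀ (k : ℕ) f, IsCompletelyMonotone f → IsCompletelyMonotone ((T ^ k) f) := by
    intro T hT k
    induction k with
    | zero => exact fun f hf => hf
    | succ k ih => exact fun f hf => by rw [pow_succ]; exact ih _ (hT f hf)
  -- `X` acts as translation by `d`, so `φ (X ^ k) = g (a + k d)`: a moment functional, with no
  -- measure needed.
  let φ (p : Polynomial ℝ) : ℝ := Polynomial.aeval S p g a
  have φ_add (p q : Polynomial ℝ) : φ (p + q) = φ p + φ q := by simp [φ]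
  have φ_C (c : ℝ) (p : Polynomial ℝ) : φ (Polynomial.C c * p) = c * φ p := by
    simp [φ, ← Polynomial.smul_eq_C_mul]
  have φ_sum (s : Finset ℕ) (p : ℕ → Polynomial ℝ) : φ (∑ k ∈ s, p k) = ∑ k ∈ s, φ (p k) := by
    simp [φ]
  -- Both `S` and `1 - S` preserve complete monotonicity, hence so do products of their powers.
  have hB (n k : ℕ) : 0 ≤ φ (bernsteinPolynomial ℝ n k) := by
    have h := (hpow S hS k _ (hpow _ hS' (n - k) g hg)).2 0 a ha
    have e : φ (bernsteinPolynomial ℝ n k) =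
        (n.choose k : ℝ) * ((S ^ k) (((1 - S) ^ (n - k)) g)) a := by
      have : bernsteinPolynomial ℝ n k =
          Polynomial.C (n.choose k : ℝ) * (Polynomial.X ^ k * (1 - Polynomial.X) ^ (n - k)) := by
        rw [bernsteinPolynomial, map_natCast, mul_assoc]
      rw [this, φ_C]
      simp [φ]
    rw [e]
    simp only [pow_zero, one_mul, iteratedDeriv_zero] at h
    positivity
  refine sq_le_mul_of_quadratic_nonneg fun u v => ?_
  have e : φ ((Polynomial.C u + Polynomial.C v * Polynomial.X) ^ 2) =
      u ^ 2 * g a + 2 * u * v * g (a + d) + v ^ 2 * g (a + d + d) := by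
    have : (Polynomial.C u + Polynomial.C v * Polynomial.X) ^ 2 =
        Polynomial.C (u ^ 2) * 1 + Polynomial.C (2 * u * v) * Polynomial.X
          + Polynomial.C (v ^ 2) * Polynomial.X ^ 2 := by
      simp only [map_pow, map_mul, map_ofNat]
      ring
    rw [this, φ_add, φ_add, φ_C, φ_C, φ_C]
    simp [φ, S, pow_two, LinearMap.funLeft_apply]
  rw [← e]
  refine nonneg_of_forall_nat_sq_mul_add
    (R := v ^ 2 * φ (Polynomial.X * (1 - Polynomial.X))) fun n _ => ?_
  have h := congrArg φ (bernsteinPolynomial_sum_sq n u v)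
  rw [φ_sum, φ_add, φ_C, φ_C] at h
  rw [← mul_assoc, ← h]
  exact Finset.sum_nonneg fun k _ => by
    rw [φ_C]
    exact mul_nonneg (sq_nonneg _) (hB n k)

end IsCompletelyMonotone

/-- If `x ↦ H (‖x‖ ^ 2)` is a positive definite kernel on every Euclidean space, then `H` is midpoint
log-convex: test the kernel on many orthogonal vectors of two different lengths. -/
theorem sq_le_mul_of_forall_posSemidef {H : ℝ → ℝ}
    (hH : ∀ n : ℕ, 1 ≤ n → ∀ (m : ℕ) (x : Fin m → EuclideanSpace ℝ (Fin n)),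
      (Matrix.of fun i j : Fin m => H (‖x i - x j‖ ^ 2)).PosSemidef)
    {a b : ℝ} (ha : 0 ≤ a) (hb : 0 ≤ b) : H ((a + b) / 2) ^ 2 ≤ H a * H b := by
  refine sq_le_mul_of_quadratic_nonneg fun u v => ?_
  refine nonneg_of_forall_nat_sq_mul_add
    (R := u ^ 2 * (H 0 - H a) + v ^ 2 * (H 0 - H b)) fun N hN => ?_
  -- Orthogonal vectors of squared lengths `a / 2` and `b / 2` have squared distances `a`, `b` or
  -- `(a + b) / 2`. Only the diagonal, where `H 0` appears, deviates; it contributes the term linear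
  -- in `N`.
  let s : Fin 2 → ℝ := ![a / 2, b / 2]
  let w : Fin 2 → ℝ := ![u, v]
  have hs (k : Fin 2) : 0 ≤ s k := by fin_cases k <;> simp only [s] <;> simp <;> positivity
  let e : Fin 2 × Fin N ≃ Fin (2 * N) := finProdFinEquiv
  let x (i : Fin (2 * N)) : EuclideanSpace ℝ (Fin (2 * N)) :=
    EuclideanSpace.single i (√(s (e.symm i).1))
  have hx (p q : Fin 2 × Fin N) : H (‖x (e p) - x (e q)‖ ^ 2) =
      H (s p.1 + s q.1) + if p = q then H 0 - H (s p.1 + s p.1) else 0 := by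
    by_cases hpq : p = q
    · subst hpq
      simp
    · rw [norm_sub_sq_real]
      simp [x, EuclideanSpace.inner_single_left, hpq, Real.sq_sqrt (hs _)]
  have hM := ((hH (2 * N) (by omega) (2 * N) x).submatrix e).dotProduct_mulVec_nonneg
    fun p => w p.1
  simp only [dotProduct, Matrix.mulVec, Matrix.submatrix_apply, Matrix.of_apply, hx] at hM
  simp only [Pi.star_apply, star_trivial, add_mul, ite_mul, zero_mul, Finset.sum_add_distrib,
    Finset.sum_ite_eq, Finset.mem_univ, if_true, mul_add, Fintype.sum_prod_type,
    Fin.sum_univ_two, Finset.sum_const, Finset.card_univ, Fintype.card_fin, nsmul_eq_mul] at hM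
  have e1 : s 0 + s 0 = a := by simp [s]
  have e2 : s 1 + s 1 = b := by simp [s]
  have e3 : s 0 + s 1 = (a + b) / 2 := by simp [s]; ring
  have e4 : s 1 + s 0 = (a + b) / 2 := by simp [s]; ring
  have w0 : w 0 = u := rfl
  have w1 : w 1 = v := rfl
  rw [e1, e2, e3, e4, w0, w1] at hM
  linarith

theorem geom_sum_pos_of_nonneg {s : ℝ} (hs : 0 ≤ s) : 0 < ∑ i ∈ Finset.range 9, s ^ i := by
  rw [Finset.sum_range_succ']
  positivity

theorem one_sub_div_one_sub_pow {s : ℝ} (h1 : s ≠ 1) :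
    (1 - s) / (1 - s ^ 9) = (∑ i ∈ Finset.range 9, s ^ i)⁻¹ := by
  have h := mul_neg_geom_sum s 9
  have h2 : 1 - s ≠ 0 := sub_ne_zero.2 h1.symm
  rw [← h, div_mul_cancel_left₀ h2]

theorem normRatio_nine (n : ℕ) (x : EuclideanSpace ℝ (Fin n)) :
    normRatio 9 n x = (∑ i ∈ Finset.range 9, ‖x‖ ^ i)⁻¹ := by
  unfold normRatio
  split_ifs with h
  · simp [h]
  · rw [← one_sub_div_one_sub_pow h, ← Real.rpow_natCast, Nat.cast_ofNat]

theorem halfRatio_nine {t : ℝ} (ht : 0 ≤ t) :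
    halfRatio 9 t = (∑ i ∈ Finset.range 9, √t ^ i)⁻¹ := by
  unfold halfRatio
  split_ifs with h
  · simp [h]
  · rw [← one_sub_div_one_sub_pow (s := √t) (by simpa using h), Real.sqrt_eq_rpow,
      ← Real.rpow_mul_natCast ht]
    norm_num

theorem halfRatio_nine_norm_sq (n : ℕ) (x : EuclideanSpace ℝ (Fin n)) :
    halfRatio 9 (‖x‖ ^ 2) = normRatio 9 n x := by
  rw [halfRatio_nine (sq_nonneg _), Real.sqrt_sq (norm_nonneg x), normRatio_nine]

theorem continuous_normRatio_nine (n : ℕ) : Continuous (normRatio 9 n) := by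
  rw [funext (normRatio_nine n)]
  exact Continuous.inv₀ (by fun_prop) fun x => (geom_sum_pos_of_nonneg (norm_nonneg x)).ne'

theorem halfRatio_nine_pos {t : ℝ} (ht : 0 ≤ t) : 0 < halfRatio 9 t := by
  rw [halfRatio_nine ht]
  exact inv_pos.2 (geom_sum_pos_of_nonneg (Real.sqrt_nonneg t))

theorem contDiffOn_halfRatio_nine : ContDiffOn ℝ (⊤ : ℕ∞) (halfRatio 9) (Ioi 0) := by
  refine ContDiffOn.congr (f := fun t => (∑ i ∈ Finset.range 9, √t ^ i)⁻¹) ?_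
    fun t ht => halfRatio_nine (le_of_lt ht)
  refine ContDiffOn.inv (ContDiffOn.sum fun i _ => ContDiffOn.pow ?_ i)
    fun t _ => (geom_sum_pos_of_nonneg (Real.sqrt_nonneg t)).ne'
  exact fun t (ht : 0 < t) => (Real.contDiffAt_sqrt ht.ne').contDiffWithinAt

theorem halfRatio_nine_mul_lt_sq :
    halfRatio 9 (9 / 25) * halfRatio 9 (16 / 25) < halfRatio 9 ((9 / 25 + 16 / 25) / 2) ^ 2 := by
  -- From the triple 3, 4, 5: both roots are rational and the midpoint is `1 / 2`. Its root is
  -- rounded up to `0.7072`, enough since the squared sum there is about 10.66, against a product of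
  -- about 10.71.
  have e1 : √(9 / 25 : ℝ) = 3 / 5 := by
    rw [show (9 / 25 : ℝ) = (3 / 5) ^ 2 by norm_num, Real.sqrt_sq (by norm_num)]
  have e2 : √(16 / 25 : ℝ) = 4 / 5 := by
    rw [show (16 / 25 : ℝ) = (4 / 5) ^ 2 by norm_num, Real.sqrt_sq (by norm_num)]
  have e3 : √((9 / 25 + 16 / 25) / 2 : ℝ) ≤ 7072 / 10000 :=
    Real.sqrt_le_iff.2 ⟨by norm_num, by norm_num⟩
  rw [halfRatio_nine (by norm_num), halfRatio_nine (by norm_num), halfRatio_nine (by norm_num),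
    e1, e2]
  have h0 := geom_sum_pos_of_nonneg (Real.sqrt_nonneg ((9 / 25 + 16 / 25) / 2))
  have h : ∑ i ∈ Finset.range 9, √((9 / 25 + 16 / 25) / 2 : ℝ) ^ i ≤
      ∑ i ∈ Finset.range 9, (7072 / 10000 : ℝ) ^ i :=
    Finset.sum_le_sum fun i _ => pow_le_pow_left₀ (Real.sqrt_nonneg _) e3 i
  refine lt_of_lt_of_le ?_ (pow_le_pow_left₀ (by positivity) (inv_anti₀ h0 h) 2)
  norm_num [Finset.sum_range_succ]

/-- The case `r = 9`: `f = normRatio 9 n` and `h = halfRatio 9`. The continuity of `f` and the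
positivity and smoothness of `h` are asserted so that none of the failures is a failure of
regularity. -/
theorem mainTheorem8 :
    (∀ n : ℕ, Continuous (normRatio 9 n)) ∧
    (∀ t : ℝ, 0 < t → 0 < halfRatio 9 t) ∧
    ContDiffOn ℝ (⊤ : ℕ∞) (halfRatio 9) (Set.Ioi 0) ∧
    -- midpoint log-convexity of `h` fails at `9/25` and `16/25`
    halfRatio 9 (9 / 25) * halfRatio 9 (16 / 25) < halfRatio 9 ((9 / 25 + 16 / 25) / 2) ^ 2 ∧
    ¬ ConvexOn ℝ (Set.Ioi 0) (fun t => Real.log (halfRatio 9 t)) ∧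
    ¬ IsCompletelyMonotone (halfRatio 9) ∧
    ¬ (∀ n : ℕ, 1 ≤ n → IsPositiveDefiniteFun (normRatio 9 n)) := by
  refine ⟨continuous_normRatio_nine, fun t ht => halfRatio_nine_pos ht.le,
    contDiffOn_halfRatio_nine, halfRatio_nine_mul_lt_sq, fun h => ?_, fun h => ?_, fun h => ?_⟩
  · have h1 := h.2 (show (9 / 25 : ℝ) ∈ Ioi 0 by norm_num [mem_Ioi])
      (show (16 / 25 : ℝ) ∈ Ioi 0 by norm_num [mem_Ioi])
      (show (0 : ℝ) ≤ 1 / 2 by norm_num) (show (0 : ℝ) ≤ 1 / 2 by norm_num) (by norm_num)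
    simp only [smul_eq_mul] at h1
    rw [show (1 / 2 * (9 / 25) + 1 / 2 * (16 / 25) : ℝ) = (9 / 25 + 16 / 25) / 2 by norm_num] at h1
    have p1 : 0 < halfRatio 9 (9 / 25) := halfRatio_nine_pos (by norm_num)
    have p2 : 0 < halfRatio 9 (16 / 25) := halfRatio_nine_pos (by norm_num)
    have h2 := Real.log_lt_log (mul_pos p1 p2) halfRatio_nine_mul_lt_sq
    rw [Real.log_mul p1.ne' p2.ne', Real.log_pow] at h2
    push_cast at h2
    linarith
  · have h1 := h.sq_le_mul (a := 9 / 25) (d := 7 / 50) (by norm_num) (by norm_num)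
    refine absurd halfRatio_nine_mul_lt_sq (not_lt.2 ?_)
    rwa [show (9 / 25 + 7 / 50 + 7 / 50 : ℝ) = 16 / 25 by norm_num,
      show (9 / 25 + 7 / 50 : ℝ) = (9 / 25 + 16 / 25) / 2 by norm_num] at h1
  · refine absurd halfRatio_nine_mul_lt_sq (not_lt.2 ?_)
    refine sq_le_mul_of_forall_posSemidef (fun n hn m x => ?_) (by norm_num) (by norm_num)
    simp only [halfRatio_nine_norm_sq]
    exact (h n hn).2 m x
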